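/- Setting. A tile of $\mathbb{R}^d$ is a compact subset homeomorphic to a closed ball, possibly carrying a decoration; a punctured tile is a tile with a chosen point (its puncture) in its interior. A punctured tiling $T$ is a countable covering of $\mathbb{R}^d$ by punctured tiles that meet only along their boundaries and are punctured coherently: if two tiles (with their decorations) are translates of each other by $a$, then so are their punctures. Let $T^{\mathrm{punc}}$ be the set of punctures. For $r>0$ and $x\in T^{\mathrm{punc}}$ let $B_r[T-x]$ be the set of tiles of $T-x$ whose punctures lie in the closed ball of radius $r$ about $0$; such a set is called an $r$-patch of $T$, and $P(r)$ denotes the number of $r$-patches. $T$ has finite local complexity if $P(r)<\infty$ for all $r>0$. Let $R(r)$ be the infimum of all $r'>0$ such that every $r'$-patch contains a translate of every $r$-patch; $T$ is linearly repetitive if $R(r)<\infty$ for all $r>0$ and there is $K>0$ with $R(r)\le Kr$ for all sufficiently large $r$. $T$ is aperiodic if $T-a=T$ only for $a=0$. For an $r$-patch $p$ let $\mathcal{L}_p=\{x\in T^{\mathrm{punc}} : B_r[T-x]=p\}$; the frequency $\mathrm{freq}(p)$ exists if, for every sequence of cubes $C_n$ of side length $n$ (with sides parallel to the axes, in arbitrary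 position), $\#(\mathcal{L}_p\cap C_n)/\mathrm{vol}(C_n)$ converges as $n\to\infty$ to one and the same limit, which is then $\mathrm{freq}(p)$. Theorem. Let $T$ be an aperiodic, linearly repetitive punctured tiling of $\mathbb{R}^d$ with finite local complexity. Then $\mathrm{freq}(p)$ exists for every $r>0$ and every $r$-patch $p$, and: 1. $T$ has equidistributed frequencies: there are constants $c,C>0$ such that $c\,P(r)^{-1}\le \mathrm{freq}(p)\le C\,P(r)^{-1}$ for all $r>0$ and all $r$-patches $p$; 2. there are constants $c,C>0$ such that $\mathrm{freq}(p)\le C\,r^{-d}$ for all $r>0$ and all $r$-patches $p$, and $c\,r^{-d}\le \mathrm{freq}(p)$ for all $r\ge 1$ and all $r$-patches $p$. -/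

import Mathlib

open Filter Topology

/-- The data of a punctured tile of `ℝ^d`, possibly decorated: a set, a chosen point, and a
decoration with values in `L` (take `L = Unit` for undecorated tiles). -/
@[ext]
structure PuncturedTile (d : ℕ) (L : Type*) where
  carrier : Set (EuclideanSpace ℝ (Fin d))
  puncture : EuclideanSpace ℝ (Fin d)
  label : L

namespace PuncturedTile

variable {d : ℕ} {L : Type*}

/-- The set of the tile is compact and homeomorphic to a closed ball, and the puncture lies in its
interior. -/
structure IsTile (t : PuncturedTile d L) : Prop where
  isCompact : IsCompact t.carrier
  homeomorphic_closedBall :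
    Nonempty (t.carrier ≃ₜ Metric.closedBall (0 : EuclideanSpace ℝ (Fin d)) 1)
  puncture_mem_interior : t.puncture ∈ interior t.carrier

/-- The translate `t + a`. -/
def translate (a : EuclideanSpace ℝ (Fin d)) (t : PuncturedTile d L) : PuncturedTile d L where
  carrier := (fun y => y + a) '' t.carrier
  puncture := t.puncture + a
  label := t.label

end PuncturedTile

/-- A punctured tiling of `ℝ^d` with decorations in `L`: a countable covering by tiles which do not
overlap except possibly at their boundaries, punctured in a translationally coherent way. -/
structure PuncturedTiling (d : ℕ) (L : Type*) where
  tiles : Set (PuncturedTile d L)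
  countable : tiles.Countable
  isTile : ∀ t ∈ tiles, t.IsTile
  covers : ⋃ t ∈ tiles, t.carrier = Set.univ
  nonoverlapping : ∀ t ∈ tiles, ∀ t' ∈ tiles, t ≠ t' →
    t.carrier ∩ t'.carrier ⊆ frontier t.carrier ∩ frontier t'.carrier
  coherent : ∀ t ∈ tiles, ∀ t' ∈ tiles, ∀ a : EuclideanSpace ℝ (Fin d),
    t.carrier = (fun y => y + a) '' t'.carrier → t.label = t'.label →
      t.puncture = t'.puncture + a

namespace PuncturedTiling

variable {d : ℕ} {L : Type*} (T : PuncturedTiling d L)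

/-- The set of punctures of the tiles of `T`. -/
def punctures : Set (EuclideanSpace ℝ (Fin d)) :=
  PuncturedTile.puncture '' T.tiles

/-- The tiles of the translated tiling `T - x`. -/
def tilesSub (x : EuclideanSpace ℝ (Fin d)) : Set (PuncturedTile d L) :=
  PuncturedTile.translate (-x) '' T.tiles

/-- The tiles of `T - x` whose punctures lie in the closed `r`-ball about the origin. -/
def patchAt (r : ℝ) (x : EuclideanSpace ℝ (Fin d)) : Set (PuncturedTile d L) :=
  {t ∈ T.tilesSub x | t.puncture ∈ Metric.closedBall (0 : EuclideanSpace ℝ (Fin d)) r}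

/-- The set of `r`-patches of `T`. -/
def patches (r : ℝ) : Set (Set (PuncturedTile d L)) :=
  T.patchAt r '' T.punctures

/-- Finite local complexity. -/
def HasFLC : Prop :=
  ∀ r : ℝ, 0 < r → (T.patches r).Finite

/-- The patch counting function `P`. -/
noncomputable def patchCount (r : ℝ) : ℕ :=
  (T.patches r).ncard

/-- The radii `r' > 0` such that every `r'`-patch of `T` contains every `r`-patch of `T` up to
translation. -/
def repetitivityRadii (r : ℝ) : Set ℝ :=
  {r' | 0 < r' ∧ ∀ q ∈ T.patches r', ∀ p ∈ T.patches r,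
    ∃ a : EuclideanSpace ℝ (Fin d), PuncturedTile.translate a '' p ⊆ q}

/-- The repetitivity function `R` is finite. -/
def IsRepetitive : Prop :=
  ∀ r : ℝ, 0 < r → (T.repetitivityRadii r).Nonempty

/-- The repetitivity function `R`. -/
noncomputable def repetitivity (r : ℝ) : ℝ :=
  sInf (T.repetitivityRadii r)

/-- `R` is finite and `R(r) ≤ K r` for some constant `K > 0` and all sufficiently large `r`. -/
def IsLinearlyRepetitive : Prop :=
  T.IsRepetitive ∧ ∃ K : ℝ, 0 < K ∧ ∀ᶠ r : ℝ in atTop, T.repetitivity r ≤ K * r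

/-- `T` has no nonzero translational period. -/
def IsAperiodic : Prop :=
  ∀ a : EuclideanSpace ℝ (Fin d), T.tilesSub a = T.tiles → a = 0

/-- The set `𝓛_p` of occurrences of the `r`-patch `p` in `T`. -/
def occurrences (r : ℝ) (p : Set (PuncturedTile d L)) : Set (EuclideanSpace ℝ (Fin d)) :=
  {x ∈ T.punctures | T.patchAt r x = p}

/-- The closed cube of side length `s` with lowest corner `a`. -/
def cube (a : EuclideanSpace ℝ (Fin d)) (s : ℝ) : Set (EuclideanSpace ℝ (Fin d)) :=
  {x | ∀ i, a i ≤ x i ∧ x i ≤ a i + s}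

/-- The frequency of the `r`-patch `p` exists and equals `f`: the number of occurrences in a cube of
side length `n`, divided by its volume, tends to `f`, for every choice of the positions of
the cubes. -/
def HasFrequency (r : ℝ) (p : Set (PuncturedTile d L)) (f : ℝ) : Prop :=
  ∀ a : ℕ → EuclideanSpace ℝ (Fin d),
    Tendsto (fun n : ℕ => ((T.occurrences r p ∩ cube (a n) (n : ℝ)).ncard : ℝ) / (n : ℝ) ^ d)
      atTop (𝓝 f)

/-- The patch frequencies exist and, up to constants, are given by `P(r)⁻¹`. -/
def HasEquidistributedFrequencies : Prop :=
  ∃ c C : ℝ, 0 < c ∧ 0 < C ∧ ∀ r : ℝ, 0 < r → ∀ p ∈ T.patches r,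
    ∃ f : ℝ, T.HasFrequency r p f ∧
      c * (T.patchCount r : ℝ)⁻¹ ≤ f ∧ f ≤ C * (T.patchCount r : ℝ)⁻¹

end PuncturedTiling

/-! Linear repetitivity gives a constant κ such that every `r`-patch occurs within distance κ·max(r,
1) of every point (`exists_repetitivity_constant`). Aperiodicity gives the opposite estimate
(`exists_repulsion_constant`): two distinct occurrences of one `r`-patch are at least δ·max(r, 1)
apart, since a smaller displacement would carry every tile of `T` to a tile and so be a period
(`tiles_translate_of_patchAt_eq`).

Frequencies exist by a subadditivity argument (`exists_forall_eventually_cubeCount`). The maximal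
count over cubes of side `s`, divided by `s ^ d`, tends to its infimum `F`. Every cube of side `m *
s` contains a copy of any given cube of side `s`; if that cube had too few points, all cubes of side
`m * s` would fall below density `F`, which is impossible. Hence minimal counts have density `F`
too.

Density and repulsion then put at least one occurrence in each cube of side 4κ·max(r, 1), and at
most one in each cube of side a small multiple of max(r, 1), so every frequency is comparable to
max(r, 1)^(-d). These frequencies sum to the density of the punctures, which does not depend on `r`;
hence `P(r)` is comparable to max(r, 1)^d, and each frequency to `P(r)⁻¹`. -/

/-- The half-open cube of side length `s` with lowest corner `a`. -/
def halfOpenCube {d : ℕ} (a : EuclideanSpace ℝ (Fin d)) (s : ℝ) : Set (EuclideanSpace ℝ (Fin d)) :=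
  {x | ∀ i, a i ≤ x i ∧ x i < a i + s}

/-- The number of points of `X` in a half-open cube. -/
noncomputable def cubeCount {d : ℕ} (X : Set (EuclideanSpace ℝ (Fin d)))
    (a : EuclideanSpace ℝ (Fin d)) (s : ℝ) : ℕ :=
  (X ∩ halfOpenCube a s).ncard

/-- The lowest corner of the cell with index `j` of the grid of mesh `s` based at `a`. -/
noncomputable def gridPoint {d : ℕ} (a : EuclideanSpace ℝ (Fin d)) (s : ℝ) (j : Fin d → ℤ) :
    EuclideanSpace ℝ (Fin d) :=
  WithLp.toLp 2 fun i => a i + s * j i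

/-! ### Grids of half-open cubes and counts of points in them. -/

section CubeCounting

variable {d : ℕ} {X : Set (EuclideanSpace ℝ (Fin d))}

theorem EuclideanSpace.norm_le_card_mul {x : EuclideanSpace ℝ (Fin d)} {c : ℝ}
    (h : ∀ i, |x i| ≤ c) : ‖x‖ ≤ d * c := by
  rcases Nat.eq_zero_or_pos d with rfl | hd
  · simp [Subsingleton.elim x 0]
  have hc : 0 ≤ c := (abs_nonneg _).trans (h ⟨0, hd⟩)
  rw [EuclideanSpace.norm_eq]
  apply Real.sqrt_le_iff.2 ⟨by positivity, ?_⟩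
  calc ∑ i, ‖x i‖ ^ 2 ≤ ∑ _i : Fin d, c ^ 2 := by
        gcongr with i; exact h i
    _ = d * c ^ 2 := by simp
    _ ≤ (d * c) ^ 2 := by
        have : (1 : ℝ) ≤ d := by exact_mod_cast hd
        nlinarith [mul_nonneg (mul_nonneg (sub_nonneg.2 this) (sq_nonneg c)) (zero_le_one.trans this)]

/-- As a condition on floors, this shows that each point lies in exactly one cell, so counts add up
without boundary corrections. -/
theorem mem_halfOpenCube_gridPoint_iff {a x : EuclideanSpace ℝ (Fin d)} {s : ℝ} (hs : 0 < s)
    {j : Fin d → ℤ} :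
    x ∈ halfOpenCube (gridPoint a s j) s ↔ ∀ i, ⌊(x i - a i) / s⌋ = j i := by
  simp only [halfOpenCube, gridPoint, Set.mem_ofPred_eq]
  refine forall_congr' fun i => ?_
  rw [Int.floor_eq_iff, le_div_iff₀ hs, div_lt_iff₀ hs]
  constructor <;> rintro ⟨h₁, h₂⟩ <;> constructor <;> linarith

theorem mem_halfOpenCube_iff_exists_grid {a x : EuclideanSpace ℝ (Fin d)} {s : ℝ} (hs : 0 < s)
    {k : ℕ} :
    x ∈ halfOpenCube a (k * s) ↔
      ∃ j ∈ Fintype.piFinset fun _ : Fin d => Finset.Ico (0 : ℤ) k,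
        x ∈ halfOpenCube (gridPoint a s j) s := by
  simp only [mem_halfOpenCube_gridPoint_iff hs, Fintype.mem_piFinset, Finset.mem_Ico]
  have key : x ∈ halfOpenCube a (k * s) ↔
      ∀ i, 0 ≤ ⌊(x i - a i) / s⌋ ∧ ⌊(x i - a i) / s⌋ < (k : ℤ) := by
    refine forall_congr' fun i => ?_
    rw [Int.floor_nonneg, Int.floor_lt, div_lt_iff₀ hs, le_div_iff₀ hs]
    push_cast
    constructor <;> rintro ⟨h₁, h₂⟩ <;> constructor <;> linarith
  rw [key]
  constructor
  · exact fun h => ⟨fun i => ⌊(x i - a i) / s⌋, h, fun i => rfl⟩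
  · rintro ⟨j, hj, h⟩ i
    rw [h i]
    exact hj i

theorem sum_cubeCount_gridPoint {s : ℝ} (hs : 0 < s)
    (hfin : ∀ b, (X ∩ halfOpenCube b s).Finite) (a : EuclideanSpace ℝ (Fin d))
    (J : Finset (Fin d → ℤ)) :
    ∑ j ∈ J, cubeCount X (gridPoint a s j) s =
      (⋃ j ∈ J, X ∩ halfOpenCube (gridPoint a s j) s).ncard := by
  have h := Set.Finite.ncard_biUnion (J.finite_toSet)
    (s := fun j => X ∩ halfOpenCube (gridPoint a s j) s) (fun j _ => hfin _) ?_
  · simp only [Finset.mem_coe] at h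
    rw [h, ← finsum_mem_coe_finset]
    rfl
  · intro j _ j' _ hne
    refine Set.disjoint_left.2 fun x hx hx' => hne ?_
    funext i
    rw [← (mem_halfOpenCube_gridPoint_iff hs).1 hx.2 i,
      ← (mem_halfOpenCube_gridPoint_iff hs).1 hx'.2 i]

theorem halfOpenCube_mul_eq_biUnion {s : ℝ} (hs : 0 < s) (a : EuclideanSpace ℝ (Fin d)) (k : ℕ) :
    X ∩ halfOpenCube a (k * s) =
      ⋃ j ∈ Fintype.piFinset fun _ : Fin d => Finset.Ico (0 : ℤ) k,
        X ∩ halfOpenCube (gridPoint a s j) s := by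
  ext x
  simp only [Set.mem_inter_iff, mem_halfOpenCube_iff_exists_grid hs, Set.mem_iUnion]
  tauto

theorem cubeCount_mul_eq_sum {s : ℝ} (hs : 0 < s)
    (hfin : ∀ b, (X ∩ halfOpenCube b s).Finite) (a : EuclideanSpace ℝ (Fin d)) (k : ℕ) :
    cubeCount X a (k * s) =
      ∑ j ∈ Fintype.piFinset fun _ : Fin d => Finset.Ico (0 : ℤ) k,
        cubeCount X (gridPoint a s j) s := by
  rw [sum_cubeCount_gridPoint hs hfin, ← halfOpenCube_mul_eq_biUnion hs, cubeCount]

theorem cubeCount_le_one {a : EuclideanSpace ℝ (Fin d)} {s : ℝ}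
    (h : (X ∩ halfOpenCube a s).Subsingleton) : cubeCount X a s ≤ 1 :=
  (Set.ncard_le_one h.finite).2 fun _ hx _ hy => h hx hy

theorem card_piFinset_Ico (k : ℕ) :
    (Fintype.piFinset fun _ : Fin d => Finset.Ico (0 : ℤ) k).card = k ^ d := by
  simp [Fintype.card_piFinset]

theorem halfOpenCube_mono {a : EuclideanSpace ℝ (Fin d)} {s t : ℝ} (h : s ≤ t) :
    halfOpenCube a s ⊆ halfOpenCube a t :=
  fun _ hx i => ⟨(hx i).1, (hx i).2.trans_le (by linarith)⟩

theorem finite_inter_halfOpenCube {δ : ℝ} (hδ : 0 < δ)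
    (hX : ∀ b, (X ∩ halfOpenCube b δ).Finite) (a : EuclideanSpace ℝ (Fin d)) (s : ℝ) :
    (X ∩ halfOpenCube a s).Finite := by
  have h : s ≤ ⌈s / δ⌉₊ * δ := (div_le_iff₀ hδ).1 (Nat.le_ceil _)
  refine Set.Finite.subset ?_ (Set.inter_subset_inter_right X (halfOpenCube_mono h))
  rw [halfOpenCube_mul_eq_biUnion hδ]
  exact Set.Finite.biUnion (Finset.finite_toSet _) fun j _ => hX _

/-- The cube is covered by `⌈s / v⌉₊ ^ d` cells of side `v`. The companion lower bound packs `⌊s /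
v⌋₊ ^ d` disjoint cells into it. -/
theorem cubeCount_le_ceil_pow_mul (hfin : ∀ b s, (X ∩ halfOpenCube b s).Finite) {v A : ℝ}
    (hv : 0 < v) (hA : ∀ b, (cubeCount X b v : ℝ) ≤ A) (a : EuclideanSpace ℝ (Fin d)) (s : ℝ) :
    (cubeCount X a s : ℝ) ≤ (⌈s / v⌉₊ : ℝ) ^ d * A := by
  have h : s ≤ ⌈s / v⌉₊ * v := (div_le_iff₀ hv).1 (Nat.le_ceil _)
  calc (cubeCount X a s : ℝ) ≤ cubeCount X a (⌈s / v⌉₊ * v) := by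
        exact_mod_cast Set.ncard_le_ncard (Set.inter_subset_inter_right X (halfOpenCube_mono h))
          (hfin _ _)
    _ ≤ _ := by
        rw [cubeCount_mul_eq_sum hv fun b => hfin b v]
        push_cast
        refine (Finset.sum_le_card_nsmul _ _ A fun j _ => hA _).trans_eq ?_
        rw [card_piFinset_Ico, nsmul_eq_mul]
        push_cast
        rfl

theorem floor_pow_mul_le_cubeCount (hfin : ∀ b s, (X ∩ halfOpenCube b s).Finite) {v A : ℝ}
    (hv : 0 < v) (hA : ∀ b, A ≤ cubeCount X b v) (a : EuclideanSpace ℝ (Fin d)) {s : ℝ}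
    (hs : 0 ≤ s) :
    (⌊s / v⌋₊ : ℝ) ^ d * A ≤ cubeCount X a s := by
  have h : ⌊s / v⌋₊ * v ≤ s := (le_div_iff₀ hv).1 (Nat.floor_le (by positivity))
  calc _ ≤ (cubeCount X a (⌊s / v⌋₊ * v) : ℝ) := by
        rw [cubeCount_mul_eq_sum hv fun b => hfin b v]
        push_cast
        refine Eq.trans_le ?_ (Finset.card_nsmul_le_sum _ _ A fun j _ => hA _)
        rw [card_piFinset_Ico, nsmul_eq_mul]
        push_cast
        rfl
    _ ≤ cubeCount X a s := by
        exact_mod_cast Set.ncard_le_ncard (Set.inter_subset_inter_right X (halfOpenCube_mono h))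
          (hfin _ _)

theorem tendsto_ceil_div_pow_mul {v : ℝ} (hv : 0 < v) (A : ℝ) :
    Tendsto (fun s : ℝ => (⌈s / v⌉₊ : ℝ) ^ d * A / s ^ d) atTop (𝓝 (A / v ^ d)) := by
  have h := ((tendsto_nat_ceil_mul_div_atTop (inv_nonneg.2 hv.le)).pow d).mul_const A
  have e : v⁻¹ ^ d * A = A / v ^ d := by rw [inv_pow, div_eq_inv_mul]
  rw [e] at h
  refine h.congr fun s => ?_
  rw [div_pow, inv_mul_eq_div]
  ring

theorem tendsto_floor_div_pow_mul {v : ℝ} (hv : 0 < v) (A : ℝ) :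
    Tendsto (fun s : ℝ => (⌊s / v⌋₊ : ℝ) ^ d * A / s ^ d) atTop (𝓝 (A / v ^ d)) := by
  have h := ((tendsto_nat_floor_mul_div_atTop (inv_nonneg.2 hv.le)).pow d).mul_const A
  have e : v⁻¹ ^ d * A = A / v ^ d := by rw [inv_pow, div_eq_inv_mul]
  rw [e] at h
  refine h.congr fun s => ?_
  rw [div_pow, inv_mul_eq_div]
  ring

/-! ### Existence of uniform densities. -/

/-- If a cube of side `s` sits inside a cube of side `m s`, the cells of mesh `s / k` inside the
small cube can be bounded by its count, and the others individually. -/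
theorem cubeCount_mul_le_of_subset (hfin : ∀ b s, (X ∩ halfOpenCube b s).Finite) {s A : ℝ}
    (hs : 0 < s) {k m : ℕ} (hk : 1 ≤ k) (hA : ∀ b, (cubeCount X b (s / k) : ℝ) ≤ A)
    {b c : EuclideanSpace ℝ (Fin d)} (hc : ∀ i, b i ≤ c i ∧ c i + s ≤ b i + m * s) :
    (cubeCount X b (m * s) : ℝ) ≤
      cubeCount X c s + (((m * k : ℕ) : ℝ) ^ d - ((k - 1 : ℕ) : ℝ) ^ d) * A := by
  have hk0 : (0 : ℝ) < k := by exact_mod_cast hk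
  set v : ℝ := s / k with hv
  have hv0 : 0 < v := by positivity
  have hkv : (k : ℝ) * v = s := by rw [hv]; field_simp
  set I := Fintype.piFinset fun _ : Fin d => Finset.Ico (0 : ℤ) (m * k : ℕ) with hI
  -- The small cube need not be aligned with the grid, so only `k - 1` full cells per direction are
  -- sure to fit in it; `σ` indexes the first grid line at or above its corner.
  set σ : Fin d → ℤ := fun i => ⌈(c i - b i) / v⌉ with hσ
  set J := Fintype.piFinset fun i : Fin d => Finset.Ico (σ i) (σ i + (k - 1 : ℕ)) with hJ
  have hσ1 : ∀ i, c i - b i ≤ σ i * v := fun i => (div_le_iff₀ hv0).1 (Int.le_ceil _)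
  have hσ2 : ∀ i, (σ i : ℝ) * v < c i - b i + v := fun i => by
    have := mul_lt_mul_of_pos_right (Int.ceil_lt_add_one ((c i - b i) / v)) hv0
    rwa [add_mul, one_mul, div_mul_cancel₀ _ hv0.ne'] at this
  have hkc : ((k - 1 : ℕ) : ℤ) = k - 1 := by push_cast [hk]; ring
  have hJI : J ⊆ I := by
    intro j hj
    rw [hI, Fintype.mem_piFinset]
    rw [hJ, Fintype.mem_piFinset] at hj
    intro i
    have h1 := Finset.mem_Ico.1 (hj i)
    rw [Finset.mem_Ico]
    constructor
    · have : 0 ≤ σ i := Int.ceil_nonneg (div_nonneg (by linarith [(hc i).1]) hv0.le)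
      exact this.trans h1.1
    · have h3 : (σ i : ℝ) * v < (((m : ℤ) * k - k + 1 : ℤ) : ℝ) * v := by
        push_cast
        have := (hc i).2
        have := hσ2 i
        rw [← hkv] at *
        linarith
      have h4 := Int.cast_lt.1 (lt_of_mul_lt_mul_right h3 hv0.le)
      push_cast
      lia
  have hJc : J.card = (k - 1) ^ d := by simp [hJ, Fintype.card_piFinset]
  have hsub : (⋃ j ∈ J, X ∩ halfOpenCube (gridPoint b v j) v) ⊆ X ∩ halfOpenCube c s := by
    refine Set.iUnion₂_subset fun j hj x hx => ⟨hx.1, fun i => ?_⟩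
    rw [hJ, Fintype.mem_piFinset] at hj
    have h1 := Finset.mem_Ico.1 (hj i)
    have h2 := hx.2 i
    simp only [gridPoint] at h2
    have h3 : (σ i : ℝ) * v ≤ j i * v := by
      gcongr; exact_mod_cast h1.1
    have h4 : (j i : ℝ) * v ≤ (σ i + k - 2) * v := by
      gcongr
      have : j i ≤ σ i + k - 2 := by lia
      exact_mod_cast this
    have := hσ1 i
    have := hσ2 i
    constructor
    · linarith
    · rw [← hkv]; linarith
  have hmk : (m : ℝ) * s = ((m * k : ℕ) : ℝ) * v := by rw [← hkv]; push_cast; ring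
  rw [hmk, cubeCount_mul_eq_sum hv0 fun b => hfin b v, ← Finset.sum_sdiff hJI,
    sum_cubeCount_gridPoint hv0 (fun b => hfin b v) b J]
  push_cast
  rw [add_comm]
  gcongr
  · exact_mod_cast Set.ncard_le_ncard hsub (hfin _ _)
  · refine (Finset.sum_le_card_nsmul _ _ A fun j _ => hA _).trans_eq ?_
    rw [Finset.card_sdiff_of_subset hJI, hI, card_piFinset_Ico, hJc, nsmul_eq_mul, Nat.cast_sub]
    · push_cast
      rfl
    · have h := Finset.card_le_card hJI
      rwa [hJc, hI, card_piFinset_Ico] at h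

/-- Uniform frequency along half-open cubes, from uniform local finiteness and the property that
every cube of side `m s` contains a cube with the same count as any given cube of side `s`. -/
theorem exists_forall_eventually_cubeCount {δ : ℝ} (hδ : 0 < δ)
    (hX : ∀ b, (X ∩ halfOpenCube b δ).Subsingleton) {m : ℕ} (hm : 0 < m) {s₀ : ℝ}
    (hrep : ∀ s, s₀ ≤ s → ∀ a b : EuclideanSpace ℝ (Fin d), ∃ c : EuclideanSpace ℝ (Fin d),
      (∀ i, b i ≤ c i ∧ c i + s ≤ b i + m * s) ∧ cubeCount X c s = cubeCount X a s) :
    ∃ F : ℝ, ∀ ε : ℝ, 0 < ε → ∀ᶠ s : ℝ in atTop, ∀ a,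
      (F - ε) * s ^ d ≤ cubeCount X a s ∧ (cubeCount X a s : ℝ) ≤ (F + ε) * s ^ d := by
  have hfin : ∀ b s, (X ∩ halfOpenCube b s).Finite := fun b s =>
    finite_inter_halfOpenCube hδ (fun b => (hX b).finite) b s
  have hone : ∀ b, (cubeCount X b δ : ℝ) ≤ 1 := fun b => by
    exact_mod_cast cubeCount_le_one (hX b)
  have hbdd : ∀ s, BddAbove (Set.range fun a => (cubeCount X a s : ℝ)) := fun s =>
    ⟨_, Set.forall_mem_range.2 fun a => cubeCount_le_ceil_pow_mul hfin hδ hone a s⟩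
  set S : ℝ → ℝ := fun s => ⨆ a, (cubeCount X a s : ℝ) with hS
  have hle : ∀ s a, (cubeCount X a s : ℝ) ≤ S s := fun s a => le_ciSup (hbdd s) a
  have hS0 : ∀ s, 0 ≤ S s := fun s => (Nat.cast_nonneg _).trans (hle s 0)
  -- As in Fekete's lemma, the density is the infimum of the normalised maximal counts.
  set Q : Set ℝ := (fun v => S v / v ^ d) '' Set.Ioi 0 with hQ
  have hQb : BddBelow Q := ⟨0, by
    rintro _ ⟨v, hv, rfl⟩
    exact div_nonneg (hS0 v) (pow_nonneg (le_of_lt hv) d)⟩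
  have hQn : Q.Nonempty := ⟨_, 1, Set.mem_Ioi.2 one_pos, rfl⟩
  have hF : ∀ v, 0 < v → sInf Q * v ^ d ≤ S v := fun v hv =>
    (le_div_iff₀ (pow_pos hv d)).1 (csInf_le hQb ⟨v, hv, rfl⟩)
  set F := sInf Q
  have upper : ∀ ε : ℝ, 0 < ε → ∀ᶠ s : ℝ in atTop, ∀ a,
      (cubeCount X a s : ℝ) ≤ (F + ε) * s ^ d := by
    intro ε hε
    obtain ⟨_, ⟨v, hv, rfl⟩, hvF⟩ := exists_lt_of_csInf_lt hQn (lt_add_of_pos_right F hε)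
    filter_upwards [(tendsto_ceil_div_pow_mul hv (S v)).eventually_lt_const hvF,
      eventually_gt_atTop 0] with s hs hs0 a
    rw [div_lt_iff₀ (pow_pos hs0 d)] at hs
    exact (cubeCount_le_ceil_pow_mul hfin hv (hle v) a s).trans hs.le
  refine ⟨F, fun ε hε => ?_⟩
  suffices h : ∀ᶠ s : ℝ in atTop, ∀ a, (F - ε) * s ^ d ≤ cubeCount X a s by
    filter_upwards [h, upper ε hε] with s h₁ h₂ a using ⟨h₁ a, h₂ a⟩
  -- The mesh `s / k` is so fine that losing one layer of cells per direction costs at most `ε / 2`;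
  -- `η` below spends the other half on the `m ^ d` volume of the surrounding cube.
  obtain ⟨k, hkF, hk⟩ : ∃ k : ℕ, F - ε / 2 < F * (((k - 1 : ℕ) : ℝ) / k) ^ d ∧ 1 ≤ k := by
    have h1 : Tendsto (fun k : ℕ => ((k : ℝ) / ((k + 1 : ℕ) : ℝ))) atTop (𝓝 1) := by
      simpa using tendsto_natCast_div_add_atTop (1 : ℝ)
    have h2 := (h1.pow d).const_mul F
    rw [one_pow, mul_one] at h2
    obtain ⟨k, hk⟩ := (h2.eventually_const_lt (show F - ε / 2 < F by linarith)).exists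
    exact ⟨k + 1, hk, by lia⟩
  have hk0 : (0 : ℝ) < k := by exact_mod_cast hk
  have hm0 : (0 : ℝ) < m := by exact_mod_cast hm
  set η : ℝ := ε / (2 * m ^ d) with hη
  have hη0 : 0 < η := by positivity
  have hdiv : Tendsto (fun s : ℝ => s / k) atTop atTop := tendsto_id.atTop_div_const hk0
  filter_upwards [hdiv.eventually (upper η hη0), eventually_ge_atTop s₀,
    eventually_gt_atTop 0] with s hup hs₀ hs a
  have hbig : S (m * s) ≤ cubeCount X a s +
      (((m * k : ℕ) : ℝ) ^ d - ((k - 1 : ℕ) : ℝ) ^ d) * ((F + η) * (s / k) ^ d) := by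
    refine ciSup_le fun b => ?_
    obtain ⟨c, hc, hca⟩ := hrep s hs₀ a b
    rw [← hca]
    exact cubeCount_mul_le_of_subset hfin hs hk hup hc
  have hlow := (hF (m * s) (by positivity)).trans hbig
  set θ : ℝ := (((k - 1 : ℕ) : ℝ) / k) ^ d with hθ
  have hθ0 : 0 ≤ θ := by positivity
  have e1 : (((m * k : ℕ) : ℝ) ^ d - ((k - 1 : ℕ) : ℝ) ^ d) * ((F + η) * (s / k) ^ d) =
      (m ^ d - θ) * (F + η) * s ^ d := by
    rw [hθ, div_pow, div_pow]
    push_cast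
    field_simp
    ring
  have e2 : (m : ℝ) ^ d * η = ε / 2 := by rw [hη]; field_simp
  rw [e1, mul_pow] at hlow
  have hs' : 0 ≤ s ^ d := by positivity
  have h3 : (F - ε) ≤ F * m ^ d - (m ^ d - θ) * (F + η) := by
    nlinarith [mul_nonneg hθ0 hη0.le]
  calc (F - ε) * s ^ d ≤ (F * m ^ d - (m ^ d - θ) * (F + η)) * s ^ d := by gcongr
    _ ≤ _ := by linarith

/-! ### Closed cubes, and bounds on densities from counts at one scale. -/

theorem halfOpenCube_subset_cube (a : EuclideanSpace ℝ (Fin d)) (s : ℝ) :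
    halfOpenCube a s ⊆ PuncturedTiling.cube a s :=
  fun _ hx i => ⟨(hx i).1, (hx i).2.le⟩

theorem cube_subset_halfOpenCube (a : EuclideanSpace ℝ (Fin d)) {s t : ℝ} (h : s < t) :
    PuncturedTiling.cube a s ⊆ halfOpenCube a t :=
  fun _ hx i => ⟨(hx i).1, (hx i).2.trans_lt (by linarith)⟩

theorem cubeCount_le_ncard_cube (hfin : ∀ b s, (X ∩ halfOpenCube b s).Finite)
    (a : EuclideanSpace ℝ (Fin d)) (s : ℝ) :
    cubeCount X a s ≤ (X ∩ PuncturedTiling.cube a s).ncard :=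
  Set.ncard_le_ncard (Set.inter_subset_inter_right X (halfOpenCube_subset_cube a s))
    ((hfin a (s + 1)).subset
      (Set.inter_subset_inter_right X (cube_subset_halfOpenCube a (lt_add_one s))))

theorem ncard_cube_le_cubeCount (hfin : ∀ b s, (X ∩ halfOpenCube b s).Finite)
    (a : EuclideanSpace ℝ (Fin d)) (s : ℝ) :
    (X ∩ PuncturedTiling.cube a s).ncard ≤ cubeCount X a (s + 1) :=
  Set.ncard_le_ncard
    (Set.inter_subset_inter_right X (cube_subset_halfOpenCube a (lt_add_one s))) (hfin _ _)

/-- Uniform frequencies along half-open cubes are frequencies along closed cubes. -/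
theorem tendsto_ncard_cube_div (hfin : ∀ b s, (X ∩ halfOpenCube b s).Finite) {F : ℝ}
    (hF : ∀ ε : ℝ, 0 < ε → ∀ᶠ s : ℝ in atTop, ∀ a,
      (F - ε) * s ^ d ≤ cubeCount X a s ∧ (cubeCount X a s : ℝ) ≤ (F + ε) * s ^ d)
    (a : ℕ → EuclideanSpace ℝ (Fin d)) :
    Tendsto (fun n : ℕ => ((X ∩ PuncturedTiling.cube (a n) n).ncard : ℝ) / (n : ℝ) ^ d)
      atTop (𝓝 F) := by
  have hratio : Tendsto (fun n : ℕ => (((n : ℝ) + 1) / n) ^ d) atTop (𝓝 1) := by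
    have h : Tendsto (fun n : ℕ => ((n : ℝ) / (n + 1))⁻¹) atTop (𝓝 1⁻¹) :=
      (tendsto_natCast_div_add_atTop (1 : ℝ)).inv₀ one_ne_zero
    simpa [inv_div] using h.pow d
  have hn := tendsto_natCast_atTop_atTop (R := ℝ)
  have hn1 : Tendsto (fun n : ℕ => (n : ℝ) + 1) atTop atTop := tendsto_atTop_add_const_right _ _ hn
  rw [tendsto_order]
  constructor
  · intro b hb
    filter_upwards [hn.eventually (hF ((F - b) / 2) (by linarith)), eventually_gt_atTop 0]
      with n h1 hn0
    have hn0' : (0 : ℝ) < n := by exact_mod_cast hn0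
    rw [lt_div_iff₀ (by positivity)]
    calc b * (n : ℝ) ^ d < (F - (F - b) / 2) * (n : ℝ) ^ d := by gcongr; linarith
      _ ≤ cubeCount X (a n) n := (h1 (a n)).1
      _ ≤ _ := by exact_mod_cast cubeCount_le_ncard_cube hfin (a n) n
  · intro b hb
    have h2 := hratio.const_mul (F + (b - F) / 2)
    rw [mul_one] at h2
    filter_upwards [hn1.eventually (hF ((b - F) / 2) (by linarith)), eventually_gt_atTop 0,
      h2.eventually_lt_const (show F + (b - F) / 2 < b by linarith)] with n h1 hn0 h3
    have hn0' : (0 : ℝ) < n := by exact_mod_cast hn0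
    rw [div_lt_iff₀ (by positivity)]
    calc ((X ∩ PuncturedTiling.cube (a n) n).ncard : ℝ) ≤ cubeCount X (a n) (n + 1) := by
          exact_mod_cast ncard_cube_le_cubeCount hfin (a n) n
      _ ≤ (F + (b - F) / 2) * ((n : ℝ) + 1) ^ d := (h1 (a n)).2
      _ = (F + (b - F) / 2) * (((n : ℝ) + 1) / n) ^ d * (n : ℝ) ^ d := by
          rw [div_pow]; field_simp
      _ < b * (n : ℝ) ^ d := by gcongr

/-- A bound valid for all cells of one fixed side passes to the density by covering a growing cube
with such cells. -/
theorem frequency_le_of_cubeCount_le (hfin : ∀ b s, (X ∩ halfOpenCube b s).Finite) {F : ℝ}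
    (hF : ∀ ε : ℝ, 0 < ε → ∀ᶠ s : ℝ in atTop, ∀ a,
      (F - ε) * s ^ d ≤ cubeCount X a s ∧ (cubeCount X a s : ℝ) ≤ (F + ε) * s ^ d)
    {v A : ℝ} (hv : 0 < v) (hA : ∀ b, (cubeCount X b v : ℝ) ≤ A) : F ≤ A / v ^ d := by
  refine le_of_forall_pos_sub_le fun ε hε => ge_of_tendsto (tendsto_ceil_div_pow_mul hv A) ?_
  filter_upwards [hF ε hε, eventually_gt_atTop 0] with s hs hs0
  rw [le_div_iff₀ (by positivity)]
  exact (hs 0).1.trans (cubeCount_le_ceil_pow_mul hfin hv hA 0 s)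

theorem le_frequency_of_le_cubeCount (hfin : ∀ b s, (X ∩ halfOpenCube b s).Finite) {F : ℝ}
    (hF : ∀ ε : ℝ, 0 < ε → ∀ᶠ s : ℝ in atTop, ∀ a,
      (F - ε) * s ^ d ≤ cubeCount X a s ∧ (cubeCount X a s : ℝ) ≤ (F + ε) * s ^ d)
    {v A : ℝ} (hv : 0 < v) (hA : ∀ b, A ≤ cubeCount X b v) : A / v ^ d ≤ F := by
  refine le_of_forall_pos_le_add fun ε hε => le_of_tendsto (tendsto_floor_div_pow_mul hv A) ?_
  filter_upwards [hF ε hε, eventually_gt_atTop 0] with s hs hs0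
  rw [div_le_iff₀ (by positivity)]
  exact (floor_pow_mul_le_cubeCount hfin hv hA 0 hs0.le).trans (hs 0).2

end CubeCounting

/-! ### Translation of tiles. -/

namespace PuncturedTile

variable {d : ℕ} {L : Type*}

@[simp]
theorem translate_zero (t : PuncturedTile d L) : t.translate 0 = t := by
  ext <;> simp [translate]

@[simp]
theorem translate_translate (t : PuncturedTile d L) (a b : EuclideanSpace ℝ (Fin d)) :
    (t.translate a).translate b = t.translate (a + b) := by
  ext <;> simp [translate, add_assoc]

@[simp]
theorem translate_puncture (t : PuncturedTile d L) (a : EuclideanSpace ℝ (Fin d)) :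
    (t.translate a).puncture = t.puncture + a := rfl

theorem add_mem_translate_carrier {t : PuncturedTile d L} {a x : EuclideanSpace ℝ (Fin d)} :
    x + a ∈ (t.translate a).carrier ↔ x ∈ t.carrier := by
  simp [translate]

theorem translate_injective (a : EuclideanSpace ℝ (Fin d)) :
    Function.Injective (translate (L := L) a) := fun t t' h => by
  simpa using congrArg (translate (-a)) h

end PuncturedTile

/-! ### Uniform geometry of tiles and patches. -/

namespace PuncturedTiling

variable {d : ℕ} {L : Type*} {T : PuncturedTiling d L}

theorem mem_tilesSub_iff {x : EuclideanSpace ℝ (Fin d)} {t : PuncturedTile d L} :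
    t ∈ T.tilesSub x ↔ t.translate x ∈ T.tiles := by
  constructor
  · rintro ⟨t, ht, rfl⟩
    simpa using ht
  · exact fun h => ⟨_, h, by simp⟩

theorem mem_patchAt_iff {r : ℝ} {x : EuclideanSpace ℝ (Fin d)} {t : PuncturedTile d L} :
    t ∈ T.patchAt r x ↔ t.translate x ∈ T.tiles ∧ ‖t.puncture‖ ≤ r := by
  simp [patchAt, mem_tilesSub_iff]

/-- Distinct tiles meet only in their frontiers, whereas a puncture is an interior point of its
tile. -/
theorem eq_of_puncture_mem_carrier {t t' : PuncturedTile d L} (ht : t ∈ T.tiles)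
    (ht' : t' ∈ T.tiles) (h : t.puncture ∈ t'.carrier) : t = t' := by
  by_contra hne
  have hi := (T.isTile t ht).puncture_mem_interior
  exact (T.nonoverlapping t ht t' ht' hne ⟨interior_subset hi, h⟩).1.2 hi

theorem eq_of_puncture_eq {t t' : PuncturedTile d L} (ht : t ∈ T.tiles) (ht' : t' ∈ T.tiles)
    (h : t.puncture = t'.puncture) : t = t' :=
  eq_of_puncture_mem_carrier ht ht'
    (h ▸ interior_subset (T.isTile t' ht').puncture_mem_interior)

theorem exists_mem_carrier (x : EuclideanSpace ℝ (Fin d)) : ∃ t ∈ T.tiles, x ∈ t.carrier := by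
  simpa using (T.covers ▸ Set.mem_univ x : x ∈ ⋃ t ∈ T.tiles, t.carrier)

/-- Finite local complexity leaves finitely many tiles up to translation. -/
theorem finite_translated_tiles (hflc : T.HasFLC) :
    ((fun t : PuncturedTile d L => t.translate (-t.puncture)) '' T.tiles).Finite := by
  -- A tile moved so that its puncture is at the origin is the unique central tile of some
  -- `1`-patch, and there are finitely many of those.
  refine ((hflc 1 one_pos).biUnion (t := fun p => {s ∈ p | s.puncture = 0}) ?_).subset ?_
  · rintro _ ⟨x, -, rfl⟩
    refine Set.Subsingleton.finite ?_
    rintro s ⟨hs, hs0⟩ s' ⟨hs', hs0'⟩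
    refine PuncturedTile.translate_injective x
      (eq_of_puncture_eq (mem_patchAt_iff.1 hs).1 (mem_patchAt_iff.1 hs').1 ?_)
    simp [hs0, hs0']
  · rintro _ ⟨t, ht, rfl⟩
    refine Set.mem_biUnion (x := T.patchAt 1 t.puncture) ⟨_, ⟨t, ht, rfl⟩, rfl⟩ ⟨?_, ?_⟩
    · simpa [mem_patchAt_iff] using ht
    · simp

/-- Tiles have uniformly bounded size, and uniformly large balls about their punctures. -/
theorem exists_uniform_tile_bounds (hflc : T.HasFLC) :
    ∃ D ρ : ℝ, 0 < D ∧ 0 < ρ ∧ ∀ t ∈ T.tiles, ∀ x,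
      (x ∈ t.carrier → ‖x - t.puncture‖ ≤ D) ∧ (‖x - t.puncture‖ < ρ → x ∈ t.carrier) := by
  have hfin := finite_translated_tiles hflc
  have hD : ∀ᶠ D : ℝ in atTop,
      ∀ s ∈ (fun t : PuncturedTile d L => t.translate (-t.puncture)) '' T.tiles,
        ∀ x ∈ s.carrier, ‖x‖ ≤ D := by
    rw [hfin.eventually_all]
    rintro _ ⟨t, ht, rfl⟩
    obtain ⟨D, hD⟩ := ((T.isTile t ht).isCompact.image
      (continuous_add_const (-t.puncture))).isBounded.exists_norm_le
    filter_upwards [eventually_ge_atTop D] with D' hD' x hx using (hD x hx).trans hD'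
  have hρ : ∀ᶠ ρ : ℝ in 𝓝[>] 0,
      ∀ s ∈ (fun t : PuncturedTile d L => t.translate (-t.puncture)) '' T.tiles,
        ∀ x, ‖x‖ < ρ → x ∈ s.carrier := by
    rw [hfin.eventually_all]
    rintro _ ⟨t, ht, rfl⟩
    obtain ⟨ε, hε, hball⟩ := Metric.mem_nhds_iff.1
      (mem_interior_iff_mem_nhds.1 (T.isTile t ht).puncture_mem_interior)
    filter_upwards [Ioo_mem_nhdsGT hε] with ρ hρ x hx
    have h : x + t.puncture ∈ t.carrier := hball (by simpa using hx.trans hρ.2)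
    simpa using PuncturedTile.add_mem_translate_carrier (a := -t.puncture).2 h
  obtain ⟨D, hD, hD0⟩ := (hD.and (eventually_gt_atTop 0)).exists
  obtain ⟨ρ, hρ, hρ0⟩ := (hρ.and self_mem_nhdsWithin).exists
  refine ⟨D, ρ, hD0, hρ0, fun t ht x => ⟨fun hx => ?_, fun hx => ?_⟩⟩
  · have := hD _ ⟨t, ht, rfl⟩ (x + -t.puncture) (PuncturedTile.add_mem_translate_carrier.2 hx)
    rwa [← sub_eq_add_neg] at this
  · refine PuncturedTile.add_mem_translate_carrier (a := -t.puncture).1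
      (hρ _ ⟨t, ht, rfl⟩ _ ?_)
    rwa [← sub_eq_add_neg]

/-- The `r`-ball about `u` lies in the `r'`-ball about the origin. The displaced centres need not be
punctures. -/
theorem patchAt_add_eq {r r' : ℝ} {x y u : EuclideanSpace ℝ (Fin d)} (hu : ‖u‖ + r ≤ r')
    (h : T.patchAt r' x = T.patchAt r' y) : T.patchAt r (x + u) = T.patchAt r (y + u) := by
  ext t
  have key := Set.ext_iff.1 h (t.translate u)
  simp only [mem_patchAt_iff, PuncturedTile.translate_translate,
    PuncturedTile.translate_puncture] at key ⊢
  rw [add_comm x u, add_comm y u]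
  refine and_congr_left fun ht => ?_
  have : ‖t.puncture + u‖ ≤ r' := (norm_add_le _ _).trans (by linarith)
  simpa [this] using key

theorem patchAt_eq_of_le {r r' : ℝ} {x y : EuclideanSpace ℝ (Fin d)} (hr : r ≤ r')
    (h : T.patchAt r' x = T.patchAt r' y) : T.patchAt r x = T.patchAt r y := by
  simpa using patchAt_add_eq (u := 0) (by simpa using hr) h

theorem add_mem_punctures {r : ℝ} {x y u : EuclideanSpace ℝ (Fin d)} (hu : ‖u‖ ≤ r)
    (h : T.patchAt r x = T.patchAt r y) (hx : x + u ∈ T.punctures) : y + u ∈ T.punctures := by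
  obtain ⟨t, ht, htx⟩ := hx
  have h1 : t.translate (-x) ∈ T.patchAt r x := by
    simp [mem_patchAt_iff, ht, htx, hu]
  rw [h, mem_patchAt_iff] at h1
  exact ⟨_, h1.1, by simp [htx]; abel⟩

theorem exists_mem_patchAt_puncture_eq_zero {r : ℝ} {x : EuclideanSpace ℝ (Fin d)} (hx : x ∈ T.punctures)
    (hr : 0 ≤ r) : ∃ t ∈ T.patchAt r x, t.puncture = 0 := by
  obtain ⟨t, ht, rfl⟩ := hx
  exact ⟨t.translate (-t.puncture), by simp [mem_patchAt_iff, ht, hr], by simp⟩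

/-- If `T - z` contains a slightly larger patch, the patch itself occurs exactly at `z`. -/
theorem patchAt_eq_of_forall_mem {D r : ℝ}
    (hD : ∀ t ∈ T.tiles, ∀ x ∈ t.carrier, ‖x - t.puncture‖ ≤ D) (hD0 : 0 ≤ D)
    {x z : EuclideanSpace ℝ (Fin d)}
    (h : ∀ t ∈ T.patchAt (r + D) x, t.translate z ∈ T.tiles) :
    T.patchAt r x = T.patchAt r z := by
  ext t
  simp only [mem_patchAt_iff]
  refine and_congr_left fun ht => ⟨fun htx => h t ?_, fun htz => ?_⟩
  · exact mem_patchAt_iff.2 ⟨htx, by linarith⟩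
  -- An extra tile of `T - z` is excluded: its puncture is covered by some tile of `T - x`, which
  -- lies in the enlarged patch and hence in `T - z`, so the two coincide.
  · obtain ⟨t₀, ht₀, hmem⟩ := T.exists_mem_carrier (t.puncture + x)
    have hmem' : t.puncture ∈ (t₀.translate (-x)).carrier := by
      simpa using PuncturedTile.add_mem_translate_carrier (a := -x).2 hmem
    have h1 : t₀.translate (-x) ∈ T.patchAt (r + D) x := by
      refine mem_patchAt_iff.2 ⟨by simpa using ht₀, ?_⟩
      have h2 := hD t₀ ht₀ _ hmem
      have h3 : (t₀.translate (-x)).puncture =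
          t.puncture - (t.puncture + x - t₀.puncture) := by
        simp; abel
      rw [h3]
      exact (norm_sub_le _ _).trans (by linarith)
    have h4 : t.translate z = (t₀.translate (-x)).translate z :=
      eq_of_puncture_mem_carrier htz (h _ h1) (PuncturedTile.add_mem_translate_carrier.2 hmem')
    rw [PuncturedTile.translate_injective z h4]
    simpa using ht₀

theorem exists_puncture_near {D : ℝ}
    (hD : ∀ t ∈ T.tiles, ∀ x ∈ t.carrier, ‖x - t.puncture‖ ≤ D)
    (y : EuclideanSpace ℝ (Fin d)) : ∃ x ∈ T.punctures, ‖x - y‖ ≤ D := by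
  obtain ⟨t, ht, hy⟩ := T.exists_mem_carrier y
  exact ⟨t.puncture, ⟨t, ht, rfl⟩, norm_sub_rev y _ ▸ hD t ht y hy⟩

/-! ### Relative density and repulsion of occurrences. -/

/-- Linear repetitivity: exact occurrences of patches are relatively dense, at a scale linear in
the radius. -/
theorem exists_repetitivity_constant (hflc : T.HasFLC) (hlin : T.IsLinearlyRepetitive) :
    ∃ κ : ℝ, 0 < κ ∧ ∀ r : ℝ, ∀ x ∈ T.punctures, ∀ y, ∃ z ∈ T.punctures,
      ‖z - y‖ ≤ κ * max r 1 ∧ T.patchAt r z = T.patchAt r x := by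
  obtain ⟨D, _, hD0, -, hDρ⟩ := exists_uniform_tile_bounds hflc
  have hD : ∀ t ∈ T.tiles, ∀ x ∈ t.carrier, ‖x - t.puncture‖ ≤ D :=
    fun t ht x hx => (hDρ t ht x).1 hx
  obtain ⟨hrep, K, hK, hev⟩ := hlin
  obtain ⟨r₀, hr₀⟩ := eventually_atTop.1 hev
  set B : ℝ := max r₀ 1 with hB
  have hB1 : 1 ≤ B := le_max_right _ _
  refine ⟨(K + 1) * (B + D) + D, by positivity, fun r x hx y => ?_⟩
  set w : ℝ := max r 1 with hw
  have hw1 : 1 ≤ w := le_max_right _ _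
  have hrw : r ≤ w * B := by nlinarith [le_max_left r 1]
  -- The factor `B` brings `s` into the range where the linear bound holds, even for small `r`; the
  -- margin `D` turns containment of patches into equality.
  set s : ℝ := w * B + D with hs
  have hBw : B ≤ w * B := by nlinarith
  have hs0 : 0 < s := by nlinarith
  have hRs : T.repetitivity s ≤ K * s := hr₀ s (by linarith [le_max_left r₀ 1])
  -- The infimum `R(s)` need not be attained, hence `K + 1` in place of `K`.
  obtain ⟨r', ⟨hr'0, hr'⟩, hr's⟩ :=
    exists_lt_of_csInf_lt (hrep s hs0) (show T.repetitivity s < (K + 1) * s by linarith)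
  obtain ⟨y', hy', hyy'⟩ := exists_puncture_near hD y
  obtain ⟨a, ha⟩ := hr' _ ⟨y', hy', rfl⟩ _ ⟨x, hx, rfl⟩
  have hmem : ∀ t ∈ T.patchAt s x, t.translate (a + y') ∈ T.tiles := fun t ht => by
    simpa using (mem_patchAt_iff.1 (ha ⟨t, ht, rfl⟩)).1
  obtain ⟨t, ht, ht0⟩ := exists_mem_patchAt_puncture_eq_zero hx hs0.le
  have hna : ‖a‖ ≤ r' := by simpa [ht0] using (mem_patchAt_iff.1 (ha ⟨t, ht, rfl⟩)).2
  refine ⟨a + y', ⟨_, hmem t ht, by simp [ht0]⟩, ?_,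
    (patchAt_eq_of_le hrw (patchAt_eq_of_forall_mem hD hD0.le hmem)).symm⟩
  have h1 : a + y' - y = a + (y' - y) := by abel
  rw [h1]
  refine (norm_add_le _ _).trans ?_
  have h2 : (K + 1) * s + D ≤ ((K + 1) * (B + D) + D) * w := by
    have h3 : s ≤ (B + D) * w := by nlinarith
    nlinarith [mul_le_mul_of_nonneg_left h3 (show 0 ≤ K + 1 by linarith)]
  linarith

/-- The neighbourhood of `t` recurs at some `z` within κ of `x`. The copy of `t` at `z` is visible
in the common `r`-patch of `x` and `y`, so it can be shifted by `y - x`. The shifted copy is still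
within `s` of `z`, so the shift is also present at the original place. -/
theorem tiles_translate_of_patchAt_eq {κ r s : ℝ} (hs : 0 ≤ s)
    (hκ : ∀ x ∈ T.punctures, ∀ y, ∃ z ∈ T.punctures,
      ‖z - y‖ ≤ κ ∧ T.patchAt s z = T.patchAt s x)
    (hr : κ ≤ r) {x y : EuclideanSpace ℝ (Fin d)} (hxy : T.patchAt r x = T.patchAt r y)
    (hs' : ‖y - x‖ ≤ s) {t : PuncturedTile d L} (ht : t ∈ T.tiles) :
    t.translate (y - x) ∈ T.tiles := by
  obtain ⟨z, -, hzx, hz⟩ := hκ t.puncture ⟨t, ht, rfl⟩ x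
  have h1 : t.translate (-t.puncture) ∈ T.patchAt s z := by
    rw [hz]
    simp [mem_patchAt_iff, ht, hs]
  have h2 : t.translate (-t.puncture + z + -x) ∈ T.patchAt r x := by
    refine mem_patchAt_iff.2 ⟨by simpa using (mem_patchAt_iff.1 h1).1, ?_⟩
    have : t.puncture + (-t.puncture + z + -x) = z - x := by abel
    rw [PuncturedTile.translate_puncture, this]
    linarith
  have h3 : t.translate (-t.puncture + (y - x)) ∈ T.patchAt s z := by
    rw [hxy] at h2
    refine mem_patchAt_iff.2 ⟨?_, ?_⟩
    · have := (mem_patchAt_iff.1 h2).1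
      rw [PuncturedTile.translate_translate] at this ⊢
      convert this using 2
      abel
    · simpa using hs'
  rw [hz] at h3
  have := (mem_patchAt_iff.1 h3).1
  rw [PuncturedTile.translate_translate] at this
  convert this using 2
  abel

/-- Occurrences of a patch of an aperiodic linearly repetitive tiling repel each other. -/
theorem exists_repulsion_constant (hflc : T.HasFLC) (haper : T.IsAperiodic)
    (hlin : T.IsLinearlyRepetitive) :
    ∃ δ : ℝ, 0 < δ ∧ ∀ r : ℝ, ∀ x ∈ T.punctures, ∀ y ∈ T.punctures,
      T.patchAt r x = T.patchAt r y → x ≠ y → δ * max r 1 ≤ ‖x - y‖ := by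
  obtain ⟨_, ρ, -, hρ, hDρ⟩ := exists_uniform_tile_bounds hflc
  obtain ⟨κ, hκ, hrep⟩ := exists_repetitivity_constant hflc hlin
  have hsep : ∀ x ∈ T.punctures, ∀ y ∈ T.punctures, x ≠ y → ρ ≤ ‖x - y‖ := by
    rintro _ ⟨t, ht, rfl⟩ _ ⟨t', ht', rfl⟩ hne
    by_contra! h
    exact hne (congrArg _ (eq_of_puncture_mem_carrier ht ht' ((hDρ t' ht' _).2 h)))
  -- The first term covers `r ≤ κ + 1` by mere separation of punctures; the second makes a
  -- displacement shorter than `δ * r` at most `s = r / (κ + 1)`, a scale at which `κ * s ≤ r`.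
  refine ⟨min (ρ / (κ + 1)) (1 / (κ + 1)), by positivity, fun r x hx y hy hxy hne => ?_⟩
  set δ := min (ρ / (κ + 1)) (1 / (κ + 1)) with hδ
  have hδ1 : δ * (κ + 1) ≤ ρ := (le_div_iff₀ (by positivity)).1 (min_le_left _ _)
  have hδ2 : δ * (κ + 1) ≤ 1 := (le_div_iff₀ (by positivity)).1 (min_le_right _ _)
  have hδ0 : 0 < δ := by positivity
  rcases le_total r (κ + 1) with hr | hr
  · refine le_trans ?_ (hsep x hx y hy hne)
    have : max r 1 ≤ κ + 1 := max_le hr (by linarith)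
    exact (mul_le_mul_of_nonneg_left this hδ0.le).trans hδ1
  · have hr1 : 1 ≤ r := by linarith
    rw [max_eq_left hr1]
    by_contra! hlt
    set s := r / (κ + 1) with hs
    have hsr : s * (κ + 1) = r := by rw [hs]; field_simp
    have hs1 : 1 ≤ s := (one_le_div (by positivity)).2 hr
    have hns : ‖x - y‖ ≤ s := by
      rw [hs, le_div_iff₀ (by positivity)]
      nlinarith
    have hκs : ∀ x ∈ T.punctures, ∀ y, ∃ z ∈ T.punctures,
        ‖z - y‖ ≤ κ * s ∧ T.patchAt s z = T.patchAt s x := fun x hx y => by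
      simpa [max_eq_left hs1] using hrep s x hx y
    have hκr : κ * s ≤ r := by nlinarith
    have hs0 : 0 ≤ s := by linarith
    refine hne (sub_eq_zero.1 (haper (x - y) (Set.ext fun t => ?_)))
    rw [mem_tilesSub_iff]
    constructor
    · intro ht
      have := tiles_translate_of_patchAt_eq hs0 hκs hκr hxy (norm_sub_rev x y ▸ hns) ht
      simpa using this
    · exact tiles_translate_of_patchAt_eq hs0 hκs hκr hxy.symm hns

end PuncturedTiling

/-! ### Existence and size of patch frequencies. -/

namespace PuncturedTiling

variable {d : ℕ} {L : Type*} {T : PuncturedTiling d L}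

/-- The crude bound of a distance by `d` times the side suffices; dividing by `d + 1` keeps it
strictly below `δ` and allows `d = 0`. -/
theorem subsingleton_inter_halfOpenCube {X : Set (EuclideanSpace ℝ (Fin d))} {δ : ℝ} (hδ : 0 < δ)
    (hX : ∀ x ∈ X, ∀ y ∈ X, x ≠ y → δ ≤ ‖x - y‖) (b : EuclideanSpace ℝ (Fin d)) :
    (X ∩ halfOpenCube b (δ / (d + 1))).Subsingleton := by
  rintro x ⟨hx, hxb⟩ y ⟨hy, hyb⟩
  by_contra hne
  have h := hX x hx y hy hne
  have h1 : ‖x - y‖ ≤ d * (δ / (d + 1)) := EuclideanSpace.norm_le_card_mul fun i => by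
    have := hxb i
    have := hyb i
    rw [PiLp.sub_apply, abs_le]
    constructor <;> linarith
  have h2 : d * (δ / (d + 1)) < δ := by
    rw [← mul_div_assoc, div_lt_iff₀ (by positivity)]
    nlinarith
  linarith

theorem add_mem_occurrences {r R : ℝ} {p : Set (PuncturedTile d L)}
    {x z u : EuclideanSpace ℝ (Fin d)} (h : T.patchAt R x = T.patchAt R z) (hu : ‖u‖ + |r| ≤ R)
    (hx : x + u ∈ T.occurrences r p) : z + u ∈ T.occurrences r p :=
  ⟨add_mem_punctures (by linarith [abs_nonneg r]) h hx.1,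
    (patchAt_add_eq (by linarith [le_abs_self r]) h).symm.trans hx.2⟩

/-- Every cube of side `m s` contains a translate of any given cube of side `s` with the same
occurrences of the patch `p`. -/
theorem exists_cube_same_cubeCount (hflc : T.HasFLC) (hlin : T.IsLinearlyRepetitive) (r : ℝ)
    (p : Set (PuncturedTile d L)) :
    ∃ m : ℕ, 0 < m ∧ ∃ s₀ : ℝ, ∀ s, s₀ ≤ s → ∀ a b : EuclideanSpace ℝ (Fin d),
      ∃ c : EuclideanSpace ℝ (Fin d), (∀ i, b i ≤ c i ∧ c i + s ≤ b i + m * s) ∧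
        cubeCount (T.occurrences r p) c s = cubeCount (T.occurrences r p) a s := by
  obtain ⟨D, _, hD0, -, hDρ⟩ := exists_uniform_tile_bounds hflc
  have hD : ∀ t ∈ T.tiles, ∀ x ∈ t.carrier, ‖x - t.puncture‖ ≤ D :=
    fun t ht x hx => (hDρ t ht x).1 hx
  obtain ⟨κ, hκ, hrep⟩ := exists_repetitivity_constant hflc hlin
  -- Around the centre of the large cube, half its side must accommodate `κ * (d + 1) * s` for the
  -- distance to the copy, `s` for the offset of the puncture from the corner, and `s` for the cube
  -- itself.
  obtain ⟨m, hm⟩ := exists_nat_ge (2 * (κ * (d + 1) + 2))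
  have hm0 : 0 < m := by
    have : (0 : ℝ) < m := lt_of_lt_of_le (by positivity) hm
    exact_mod_cast this
  refine ⟨m, hm0, max (D + |r|) 1, fun s hs a b => ?_⟩
  have hsD : D + |r| ≤ s := (le_max_left _ _).trans hs
  have hs1 : 1 ≤ s := (le_max_right _ _).trans hs
  -- An `R`-patch centred within `D` of `a` determines the `r`-patches at all punctures in the cube
  -- at `a`.
  set R : ℝ := d * s + D + |r| with hR
  have hRs : max R 1 ≤ (d + 1) * s := by
    have : 0 ≤ (d : ℝ) * s := by positivity
    refine max_le ?_ ?_ <;> linarith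
  obtain ⟨x, hx, hxa⟩ := exists_puncture_near hD a
  obtain ⟨z, hz, hzy, hzx⟩ := hrep R x hx (WithLp.toLp 2 fun i => b i + m * s / 2)
  have hnear : ∀ q q' : EuclideanSpace ℝ (Fin d), q ∈ halfOpenCube q' s → ‖q - q'‖ ≤ d * s :=
    fun q q' hq => EuclideanSpace.norm_le_card_mul fun i => by
      have := hq i
      rw [PiLp.sub_apply, abs_le]
      constructor <;> linarith
  refine ⟨a + (z - x), fun i => ?_, ?_⟩
  · have h1 := abs_le.1 ((PiLp.norm_apply_le _ i).trans hzy)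
    have h2 := abs_le.1 ((PiLp.norm_apply_le _ i).trans hxa)
    simp only [PiLp.sub_apply, PiLp.add_apply] at h1 h2 ⊢
    have h3 : κ * max R 1 ≤ κ * (d + 1) * s := by nlinarith
    have h4 : 2 * (κ * (d + 1) + 2) * s ≤ m * s := by nlinarith
    have h5 := abs_nonneg r
    constructor <;> linarith
  · have himage : T.occurrences r p ∩ halfOpenCube (a + (z - x)) s =
        (fun q => q + (z - x)) '' (T.occurrences r p ∩ halfOpenCube a s) := by
      ext q
      constructor
      · rintro ⟨hq, hqc⟩
        have hqa : q - (z - x) ∈ halfOpenCube a s := fun i => by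
          have := hqc i
          simp only [PiLp.sub_apply, PiLp.add_apply] at this ⊢
          constructor <;> linarith
        refine ⟨q - (z - x), ⟨?_, hqa⟩, by simp⟩
        have h1 : ‖q - z‖ ≤ d * s + D := by
          have e : q - z = (q - (z - x) - a) - (x - a) := by abel
          rw [e]
          exact (norm_sub_le _ _).trans (add_le_add (hnear _ _ hqa) hxa)
        have h2 := add_mem_occurrences (u := q - z) (p := p) (r := r) hzx
          (by linarith) (by simpa using hq)
        convert h2 using 1
        abel
      · rintro ⟨q, ⟨hq, hqa⟩, rfl⟩
        refine ⟨?_, fun i => ?_⟩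
        · have h1 : ‖q - x‖ ≤ d * s + D := by
            have e : q - x = (q - a) - (x - a) := by abel
            rw [e]
            exact (norm_sub_le _ _).trans (add_le_add (hnear _ _ hqa) hxa)
          have h2 := add_mem_occurrences (u := q - x) (p := p) (r := r) hzx.symm
            (by linarith) (by simpa using hq)
          convert h2 using 1
          simp only
          abel
        · have := hqa i
          simp only [PiLp.sub_apply, PiLp.add_apply]
          constructor <;> linarith
    rw [cubeCount, himage, Set.ncard_image_of_injective _ (add_left_injective _), cubeCount]

/-- Using `max r 1` gives constants valid for all radii at once; both claims of the theorem follow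
from this estimate. -/
theorem exists_hasFrequency_bounds (hflc : T.HasFLC) (haper : T.IsAperiodic)
    (hlin : T.IsLinearlyRepetitive) :
    ∃ c C : ℝ, 0 < c ∧ 0 < C ∧ ∀ r : ℝ, ∀ p ∈ T.patches r, ∃ f : ℝ, T.HasFrequency r p f ∧
      c * (max r 1 ^ d)⁻¹ ≤ f ∧ f ≤ C * (max r 1 ^ d)⁻¹ := by
  obtain ⟨δ, hδ, hrepel⟩ := exists_repulsion_constant hflc haper hlin
  obtain ⟨κ, hκ, hrep⟩ := exists_repetitivity_constant hflc hlin
  refine ⟨((4 * κ) ^ d)⁻¹, ((δ / (d + 1)) ^ d)⁻¹, by positivity, by positivity, ?_⟩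
  rintro r _ ⟨x, hx, rfl⟩
  set X := T.occurrences r (T.patchAt r x) with hXdef
  set w : ℝ := max r 1 with hw
  have hw1 : 1 ≤ w := le_max_right _ _
  have hδw : 0 < δ * w := by positivity
  have hX : ∀ b, (X ∩ halfOpenCube b (δ * w / (d + 1))).Subsingleton :=
    subsingleton_inter_halfOpenCube hδw fun y hy y' hy' hne =>
      hrepel r y hy.1 y' hy'.1 (hy.2.trans hy'.2.symm) hne
  have hv : 0 < δ * w / (d + 1) := by positivity
  have hfin : ∀ b s, (X ∩ halfOpenCube b s).Finite := fun b s =>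
    finite_inter_halfOpenCube hv (fun b => (hX b).finite) b s
  obtain ⟨m, hm, s₀, hcopy⟩ := exists_cube_same_cubeCount hflc hlin r (T.patchAt r x)
  obtain ⟨f, hf⟩ := exists_forall_eventually_cubeCount hv hX hm hcopy
  refine ⟨f, tendsto_ncard_cube_div hfin hf, ?_, ?_⟩
  · have h := le_frequency_of_le_cubeCount hfin hf (v := 4 * κ * w) (A := 1) (by positivity)
      fun b => ?_
    · rwa [mul_pow, one_div, mul_inv] at h
    · obtain ⟨z, hz, hzb, hzx⟩ := hrep r x hx (WithLp.toLp 2 fun i => b i + 2 * κ * w)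
      have hzX : z ∈ X ∩ halfOpenCube b (4 * κ * w) := by
        refine ⟨⟨hz, hzx⟩, fun i => ?_⟩
        have h1 := abs_le.1 ((PiLp.norm_apply_le _ i).trans hzb)
        simp only [PiLp.sub_apply] at h1
        have : 0 < κ * w := by positivity
        constructor <;> linarith
      exact_mod_cast (Set.ncard_pos (hfin _ _)).2 ⟨z, hzX⟩
  · have h := frequency_le_of_cubeCount_le hfin hf hv (A := 1) fun b => by
      exact_mod_cast cubeCount_le_one (hX b)
    have e : δ * w / (d + 1) = δ / (d + 1) * w := by ring
    rwa [e, mul_pow, one_div, mul_inv] at h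

theorem biUnion_occurrences (r : ℝ) :
    ⋃ p ∈ T.patches r, T.occurrences r p = T.punctures := by
  ext x
  simp only [Set.mem_iUnion, exists_prop]
  exact ⟨fun ⟨p, _, hx⟩ => hx.1, fun hx => ⟨_, ⟨x, hx, rfl⟩, hx, rfl⟩⟩

theorem finite_occurrences_inter_cube (hflc : T.HasFLC) (haper : T.IsAperiodic)
    (hlin : T.IsLinearlyRepetitive) (r : ℝ) (p : Set (PuncturedTile d L))
    (a : EuclideanSpace ℝ (Fin d)) (s : ℝ) : (T.occurrences r p ∩ cube a s).Finite := by
  obtain ⟨δ, hδ, hrepel⟩ := exists_repulsion_constant hflc haper hlin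
  have hδw : 0 < δ * max r 1 := mul_pos hδ (lt_max_of_lt_right one_pos)
  have hX : ∀ b, (T.occurrences r p ∩ halfOpenCube b (δ * max r 1 / (d + 1))).Subsingleton :=
    subsingleton_inter_halfOpenCube hδw fun y hy y' hy' hne =>
      hrepel r y hy.1 y' hy'.1 (hy.2.trans hy'.2.symm) hne
  refine (finite_inter_halfOpenCube (div_pos hδw (by positivity)) (fun b => (hX b).finite) a
    (s + 1)).subset ?_
  exact Set.inter_subset_inter_right _ (cube_subset_halfOpenCube a (lt_add_one s))

/-- The frequencies of the `r`-patches sum up to the density of the punctures. -/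
theorem tendsto_ncard_punctures (hflc : T.HasFLC) (haper : T.IsAperiodic)
    (hlin : T.IsLinearlyRepetitive) {r : ℝ} (hr : 0 < r) {f : Set (PuncturedTile d L) → ℝ}
    (hf : ∀ p ∈ T.patches r, T.HasFrequency r p (f p)) :
    Tendsto (fun n : ℕ => ((T.punctures ∩ cube 0 (n : ℝ)).ncard : ℝ) / (n : ℝ) ^ d) atTop
      (𝓝 (∑ p ∈ (hflc r hr).toFinset, f p)) := by
  have h := tendsto_finsetSum (hflc r hr).toFinset fun p hp =>
    hf p ((hflc r hr).mem_toFinset.1 hp) fun _ => 0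
  refine h.congr fun n => ?_
  rw [← Finset.sum_div, ← biUnion_occurrences r, Set.iUnion₂_inter,
    (hflc r hr).ncard_biUnion (fun p _ => finite_occurrences_inter_cube hflc haper hlin r p _ _) ?_,
    finsum_mem_eq_finite_toFinset_sum _ (hflc r hr)]
  · push_cast
    rfl
  · intro p _ q _ hne
    exact Set.disjoint_left.2 fun x hx hx' => hne (hx.1.2.symm.trans hx'.1.2)

end PuncturedTiling

/-! ### Comparison of frequencies with the patch counting function. -/

theorem mainTheorem8 {d : ℕ} {L : Type*} (T : PuncturedTiling d L)
    (hflc : T.HasFLC) (haper : T.IsAperiodic) (hlin : T.IsLinearlyRepetitive) :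
    T.HasEquidistributedFrequencies ∧
      ∃ c C : ℝ, 0 < c ∧ 0 < C ∧ ∀ r : ℝ, 0 < r → ∀ p ∈ T.patches r,
        ∃ f : ℝ, T.HasFrequency r p f ∧
          (1 ≤ r → c * r ^ (-(d : ℤ)) ≤ f) ∧ f ≤ C * r ^ (-(d : ℤ)) := by
  obtain ⟨c, C, hc, hC, h⟩ := PuncturedTiling.exists_hasFrequency_bounds hflc haper hlin
  constructor
  · choose! f hf hcf hfC using h
    -- Every puncture carries exactly one `r`-patch, so for each `r` the sum is the density of all
    -- punctures.
    have hlim : ∀ r (hr : 0 < r), ∑ p ∈ (hflc r hr).toFinset, f r p =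
        ∑ p ∈ (hflc 1 one_pos).toFinset, f 1 p := fun r hr =>
      tendsto_nhds_unique
        (PuncturedTiling.tendsto_ncard_punctures hflc haper hlin hr (hf r))
        (PuncturedTiling.tendsto_ncard_punctures hflc haper hlin one_pos (hf 1))
    set ρ : ℝ := ∑ p ∈ (hflc 1 one_pos).toFinset, f 1 p with hρdef
    have hcard : ∀ r (hr : 0 < r), (hflc r hr).toFinset.card = T.patchCount r := fun r hr =>
      (Set.ncard_eq_toFinset_card _ _).symm
    have hlow : ∀ r, 0 < r → T.patchCount r * (c * (max r 1 ^ d)⁻¹) ≤ ρ := fun r hr => by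
      rw [← hlim r hr, ← hcard r hr, ← nsmul_eq_mul]
      exact Finset.card_nsmul_le_sum _ _ _ fun p hp =>
        hcf r p ((hflc r hr).mem_toFinset.1 hp)
    have hup : ∀ r, 0 < r → ρ ≤ T.patchCount r * (C * (max r 1 ^ d)⁻¹) := fun r hr => by
      rw [← hlim r hr, ← hcard r hr, ← nsmul_eq_mul]
      exact Finset.sum_le_card_nsmul _ _ _ fun p hp =>
        hfC r p ((hflc r hr).mem_toFinset.1 hp)
    have hpos : ∀ r, 0 < r → (T.patches r).Nonempty → (0 : ℝ) < T.patchCount r :=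
      fun r hr hne => by exact_mod_cast (Set.ncard_pos (hflc r hr)).2 hne
    have hρ : 0 < ρ := by
      obtain ⟨t, ht, -⟩ := T.exists_mem_carrier 0
      refine lt_of_lt_of_le ?_ (hlow 1 one_pos)
      have := hpos 1 one_pos ⟨_, t.puncture, ⟨t, ht, rfl⟩, rfl⟩
      positivity
    refine ⟨c * ρ / C, C * ρ / c, by positivity, by positivity, fun r hr p hp =>
      ⟨f r p, hf r p hp, ?_, ?_⟩⟩
    · refine le_trans ?_ (hcf r p hp)
      have hP := hpos r hr ⟨p, hp⟩
      rw [← div_eq_mul_inv, div_le_iff₀ hP, div_le_iff₀ hC]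
      calc c * ρ ≤ c * (T.patchCount r * (C * (max r 1 ^ d)⁻¹)) := by
            gcongr; exact hup r hr
        _ = _ := by ring
    · refine (hfC r p hp).trans ?_
      have hP := hpos r hr ⟨p, hp⟩
      rw [← div_eq_mul_inv _ (T.patchCount r : ℝ), le_div_iff₀ hP, le_div_iff₀ hc]
      calc _ = C * (T.patchCount r * (c * (max r 1 ^ d)⁻¹)) := by ring
        _ ≤ C * ρ := by gcongr; exact hlow r hr
  · refine ⟨c, C, hc, hC, fun r hr p hp => ?_⟩
    obtain ⟨f, hf, hcf, hfC⟩ := h r p hp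
    rw [zpow_neg, zpow_natCast]
    refine ⟨f, hf, fun hr1 => by rwa [max_eq_left hr1] at hcf, hfC.trans ?_⟩
    -- For `r < 1` the upper bound survives because `r ≤ max r 1`.
    gcongr
    exact le_max_left r 1
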